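/- A bigraph $F=(U_1,U_2,E)$ consists of finite sets $U_1,U_2$ and a set $E\subseteq U_1\times U_2$; write $|V|=|U_1|+|U_2|$ for its number of nodes. A graphon $(J,W)$ consists of a probability space $J$ with measure $\pi$ and a measurable symmetric function $W:J\times J\to[0,1]$. It excludes $F$ as an induced sub-bigraph if \[ \int_{J^{U_1}}\int_{J^{U_2}}\ \prod_{ij\in E}W(x_i,y_j)\prod_{ij\in (U_1\times U_2)\setminus E}\bigl(1-W(x_i,y_j)\bigr)\,dy\,dx=0 . \] For a finite partition $\mathcal P$ of $J$ into measurable sets of positive measure, let $W_{\mathcal P}(x,y)=\frac{1}{\pi(S(x))\pi(S(y))}\int_{S(x)\times S(y)}W\,d(\pi\times\pi)$, where $S(x)$ is the class of $\mathcal P$ containing $x$; $\mathcal P$ is an ultra-strong regularity partition of $(J,W)$ with error $\varepsilon$ if $\|W-W_{\mathcal P}\|_1=\int_{J\times J}|W-W_{\mathcal P}|\,d(\pi\times\pi)\le\varepsilon$. Theorem. For every bigraph $F=(U_1,U_2,E)$ there is a constant $c_F>0$, depending only on $F$, such that for every graphon $(J,W)$ that excludes $F$ as an induced sub-bigraph and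 every $0<\varepsilon<1$, $(J,W)$ has an ultra-strong regularity partition with error $\varepsilon$ into at most $c_F\,\varepsilon^{-10|V|^2}$ classes. -/

import Mathlib

open MeasureTheory

noncomputable section

/-- A bigraph `(U₁, U₂, E)` with node classes `U₁`, `U₂` and edge set `E ⊆ U₁ × U₂`. -/
structure Bigraph (U₁ U₂ : Type*) where
  edges : Set (U₁ × U₂)

/-- A bigraphon: a measurable function `J₁ × J₂ → [0,1]`. The probability measures on `J₁` and
`J₂` are passed as arguments wherever they are used. -/
structure Bigraphon (J₁ J₂ : Type*) [MeasurableSpace J₁] [MeasurableSpace J₂] where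
  toFun : J₁ → J₂ → ℝ
  measurable_uncurry : Measurable (Function.uncurry toFun)
  mem_Icc : ∀ x y, toFun x y ∈ Set.Icc (0 : ℝ) 1

/-- A graphon: a symmetric bigraphon with `J₁ = J₂`. -/
structure Graphon (J : Type*) [MeasurableSpace J] extends Bigraphon J J where
  symm : ∀ x y, toFun x y = toFun y x

namespace Bigraphon

variable {J₁ J₂ : Type*} [MeasurableSpace J₁] [MeasurableSpace J₂]

open Classical in
/-- `∏_{ij ∈ E} W(x_i, y_j) · ∏_{ij ∉ E} (1 - W(x_i, y_j))`. -/
def indWeight {U₁ U₂ : Type*} [Fintype U₁] [Fintype U₂] (W : Bigraphon J₁ J₂)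
    (F : Bigraph U₁ U₂) (x : U₁ → J₁) (y : U₂ → J₂) : ℝ :=
  (∏ e : U₁ × U₂ with e ∈ F.edges, W.toFun (x e.1) (y e.2)) *
    ∏ e : U₁ × U₂ with e ∉ F.edges, (1 - W.toFun (x e.1) (y e.2))

/-- The induced density of the bigraph `F` in the bigraphon `W`: the integral of `indWeight`
over independent choices of the points `x_i` (from `π₁`) and `y_j` (from `π₂`). -/
def indDensity {U₁ U₂ : Type*} [Fintype U₁] [Fintype U₂] (W : Bigraphon J₁ J₂)
    (π₁ : Measure J₁) (π₂ : Measure J₂) (F : Bigraph U₁ U₂) : ℝ :=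
  ∫ x : U₁ → J₁, ∫ y : U₂ → J₂, W.indWeight F x y
    ∂(Measure.pi fun _ => π₂) ∂(Measure.pi fun _ => π₁)

end Bigraphon

namespace Graphon

variable {J : Type*} [MeasurableSpace J]

/-- The graphon `W` excludes the bigraph `F` as an induced sub-bigraph: the induced density of
`F` in `W`, regarded as a bigraphon, is zero. -/
def ExcludesInduced {U₁ U₂ : Type*} [Fintype U₁] [Fintype U₂] (W : Graphon J)
    (π : Measure J) (F : Bigraph U₁ U₂) : Prop :=
  W.toBigraphon.indDensity π π F = 0

/-- `P` is a (finite) partition of `J` into measurable sets of positive measure. -/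
structure IsMeasurablePartition (π : Measure J) (P : Finset (Set J)) : Prop where
  isPartition : Setoid.IsPartition (P : Set (Set J))
  measurableSet : ∀ S ∈ P, MeasurableSet S
  measure_pos : ∀ S ∈ P, 0 < π S

/-- The class `S(x)` of the partition `P` that contains `x`. -/
def classOf (P : Finset (Set J)) (x : J) : Set J :=
  ⋃₀ {S : Set J | S ∈ P ∧ x ∈ S}

/-- The averaged function `W_P`: the mean of `W` over `S(x) × S(y)`. -/
def stepAverage (W : Graphon J) (π : Measure J) (P : Finset (Set J)) (x y : J) : ℝ :=
  (π.real (classOf P x) * π.real (classOf P y))⁻¹ *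
    ∫ z in classOf P x ×ˢ classOf P y, W.toFun z.1 z.2 ∂(π.prod π)

/-- `P` is an ultra-strong regularity partition of `W` with error `ε`: `‖W - W_P‖₁ ≤ ε`. -/
def IsUltraStrongPartition (W : Graphon J) (π : Measure J) (P : Finset (Set J)) (ε : ℝ) : Prop :=
  IsMeasurablePartition π P ∧
    ∫ z : J × J, |W.toFun z.1 z.2 - W.stepAverage π P z.1 z.2| ∂(π.prod π) ≤ ε

end Graphon

end

/-!
Exclusion of `F` has two consequences: `W` is a.e. `0`- or `1`-valued, since every pattern has
positive weight where `W` is fractional, and almost no choice of rows and columns spans an induced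
copy of `F` in the supports of the rows. If many rows had pairwise `δ`-separated supports, a random
sample of columns would distinguish them all, and by Sauer–Shelah they would cut out every subset
of some `|V|` sampled columns, hence a copy of `F`. So boundedly many rows form a `δ`-net, and the
partition groups each point with a nearby centre. Averaging over its classes is an invariant Markov
kernel, so the `L¹` error is at most the row variation plus the column variation within classes.
-/

open ProbabilityTheory
open scoped ENNReal Finset symmDiff

section Combinatorics

variable {α β γ : Type*}

theorem card_le_pow_vcDim [Fintype β] [DecidableEq β] (𝒜 : Finset (Finset β)) :
    #𝒜 ≤ (Fintype.card β + 1) ^ 𝒜.vcDim := by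
  calc #𝒜 ≤ ∑ k ∈ Finset.Iic 𝒜.vcDim, (Fintype.card β).choose k :=
        (Finset.card_le_card_shatterer 𝒜).trans Finset.card_shatterer_le_sum_vcDim
    _ ≤ ∑ k ∈ Finset.Iic 𝒜.vcDim, Fintype.card β ^ k * 1 ^ (𝒜.vcDim - k) * 𝒜.vcDim.choose k := by
        refine Finset.sum_le_sum fun k hk => (Nat.choose_le_pow _ _).trans ?_
        rw [one_pow, mul_one]
        exact Nat.le_mul_of_pos_right _ (Nat.choose_pos (Finset.mem_Iic.1 hk))
    _ = (Fintype.card β + 1) ^ 𝒜.vcDim := by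
        simp only [add_pow, Nat.range_succ_eq_Iic, Nat.cast_id]

theorem exists_shatters_of_pow_lt_card [Fintype β] [DecidableEq β] {𝒜 : Finset (Finset β)} {d : ℕ}
    (h : (Fintype.card β + 1) ^ d < #𝒜) : ∃ s, 𝒜.Shatters s ∧ d < #s := by
  have hd : d < 𝒜.vcDim := by
    by_contra! hle
    exact h.not_ge ((card_le_pow_vcDim 𝒜).trans (Nat.pow_le_pow_right (Nat.succ_pos _) hle))
  obtain ⟨s, hs, hcard⟩ := Finset.lt_sup_iff.1 hd
  exact ⟨s, Finset.mem_shatterer.1 hs, hcard⟩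

theorem exists_forall_preimage_eq_of_pow_lt_card [Fintype α] [Fintype β] [Fintype γ]
    {A : α → Set β} (hA : Function.Injective A)
    (h : (Fintype.card β + 1) ^ Fintype.card γ < Fintype.card α) :
    ∃ φ : γ → β, ∀ u : Set γ, ∃ a, φ ⁻¹' A a = u := by
  classical
  have hcard : #(Finset.univ.image fun a => (A a).toFinset) = Fintype.card α :=
    Finset.card_image_of_injective _ fun _ _ haa' => hA (Set.toFinset_inj.1 haa')
  obtain ⟨s, hs, hγs⟩ := exists_shatters_of_pow_lt_card (hcard ▸ h)
  obtain ⟨φ⟩ : Nonempty (γ ↪ s) := by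
    rw [Function.Embedding.nonempty_iff_card_le, Fintype.card_coe]
    exact hγs.le
  refine ⟨fun c => φ c, fun u => ?_⟩
  have hsub : (u.toFinset.map φ).map (Function.Embedding.subtype _) ⊆ s := fun b hb => by
    obtain ⟨b', -, rfl⟩ := Finset.mem_map.1 hb
    exact b'.2
  obtain ⟨t, ht, hst⟩ := hs hsub
  obtain ⟨a, -, rfl⟩ := Finset.mem_image.1 ht
  refine ⟨a, Set.ext fun c => ?_⟩
  have hc := congrArg ((φ c : β) ∈ ·) hst
  simpa using hc

namespace Bigraph

variable {U₁ U₂ : Type*} (F : Bigraph U₁ U₂)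

/-- The points `x` and `y` span an induced copy of the bigraph `F` in the bipartite relation whose
neighbourhoods are the sets `A a`. The points need not be distinct. -/
def IsInducedCopy (A : α → Set β) (x : U₁ → α) (y : U₂ → β) : Prop :=
  ∀ i j, y j ∈ A (x i) ↔ (i, j) ∈ F.edges

theorem exists_isInducedCopy_of_forall_preimage_eq {A : α → Set β} {φ : U₁ ⊕ U₂ → β}
    (hφ : ∀ u, ∃ a, φ ⁻¹' A a = u) :
    ∃ x y, Function.Injective x ∧ Function.Injective y ∧ F.IsInducedCopy A x y := by
  -- The first summand marks the vertices of `U₁`, which makes their representatives distinct.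
  choose x hx using fun i => hφ ({Sum.inl i} ∪ Sum.inr '' {j | (i, j) ∈ F.edges})
  refine ⟨x, φ ∘ Sum.inr, fun i i' hii' => ?_, fun j j' hjj' => ?_, fun i j => ?_⟩
  · have h : Sum.inl i ∈ φ ⁻¹' A (x i') := by rw [← hii', hx]; simp
    simpa [hx] using h
  · obtain ⟨a, ha⟩ := hφ {Sum.inr j'}
    have h : Sum.inr j ∈ φ ⁻¹' A a := by
      rw [Set.mem_preimage, show φ (Sum.inr j) = φ (Sum.inr j') from hjj', ← Set.mem_preimage, ha]
      rfl
    simpa [ha] using h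
  · change Sum.inr j ∈ φ ⁻¹' A (x i) ↔ _
    simp [hx]

theorem exists_isInducedCopy_of_pow_lt_card [Fintype U₁] [Fintype U₂] [Fintype α] [Fintype β]
    {A : α → Set β} (hA : Function.Injective A)
    (h : (Fintype.card β + 1) ^ Fintype.card (U₁ ⊕ U₂) < Fintype.card α) :
    ∃ x y, Function.Injective x ∧ Function.Injective y ∧ F.IsInducedCopy A x y :=
  have ⟨_, hφ⟩ := exists_forall_preimage_eq_of_pow_lt_card hA h
  F.exists_isInducedCopy_of_forall_preimage_eq hφ

end Bigraph

end Combinatorics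

section Sampling

theorem measurePreserving_pi_reindex {ι κ : Type*} [Fintype ι] [Fintype κ] {α : κ → Type*}
    [∀ k, MeasurableSpace (α k)] (μ : ∀ k, Measure (α k)) [∀ k, IsProbabilityMeasure (μ k)]
    {f : ι → κ} (hf : Function.Injective f) :
    MeasurePreserving (fun x i => x (f i)) (Measure.pi μ) (Measure.pi fun i => μ (f i)) := by
  refine ⟨by fun_prop, ?_⟩
  have hindep := (iIndepFun_pi (μ := μ) (X := fun _ => id) fun _ => aemeasurable_id).precomp hf
  refine ((iIndepFun_iff_map_fun_eq_pi_map fun i =>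
    (measurable_pi_apply (f i)).aemeasurable).1 hindep).trans ?_
  congr 1 with i : 1
  exact (measurePreserving_eval μ (f i)).map_eq

variable {β : Type*} [MeasurableSpace β] {ν : Measure β} [IsProbabilityMeasure ν]

theorem measureReal_pi_preimage_eq {κ : Type*} [Fintype κ] {A B : Set β} (hA : MeasurableSet A)
    (hB : MeasurableSet B) :
    (Measure.pi fun _ : κ => ν).real {y | y ⁻¹' A = y ⁻¹' B} =
      (1 - ν.real (A ∆ B)) ^ Fintype.card κ := by
  have hpi : {y : κ → β | y ⁻¹' A = y ⁻¹' B} = Set.univ.pi fun _ => (A ∆ B)ᶜ := by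
    ext y
    simp only [Set.ext_iff, Set.mem_univ_pi, Set.mem_compl_iff, Set.mem_symmDiff,
      Set.mem_preimage, Set.mem_ofPred_eq]
    exact forall_congr' fun k => by tauto
  rw [hpi, ← probReal_compl_eq_one_sub (hA.symmDiff hB)]
  simp [Measure.real, Measure.pi_pi]

theorem measureReal_pi_not_injective_preimage_le {ι κ : Type*} [Fintype ι] [Fintype κ]
    {A : ι → Set β} (hA : ∀ i, MeasurableSet (A i)) {δ : ℝ} (hδ : δ ≤ 1)
    (hsep : Pairwise fun i j => δ ≤ ν.real (A i ∆ A j)) :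
    (Measure.pi fun _ : κ => ν).real {y | ¬ Function.Injective fun i => y ⁻¹' A i} ≤
      Fintype.card ι ^ 2 * (1 - δ) ^ Fintype.card κ := by
  classical
  let offDiag : Finset (ι × ι) := Finset.univ.offDiag
  have hcover : {y : κ → β | ¬ Function.Injective fun i => y ⁻¹' A i} ⊆
      ⋃ p ∈ offDiag, {y | y ⁻¹' A p.1 = y ⁻¹' A p.2} := fun y hy => by
    obtain ⟨i, j, hij, hne⟩ := Function.not_injective_iff.1 hy
    exact Set.mem_biUnion (x := (i, j)) (by simpa [offDiag] using hne) hij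
  have hpair : ∀ p ∈ offDiag, (Measure.pi fun _ : κ => ν).real {y | y ⁻¹' A p.1 = y ⁻¹' A p.2} ≤
      (1 - δ) ^ Fintype.card κ := fun p hp => by
    rw [measureReal_pi_preimage_eq (hA _) (hA _)]
    have hp' : p.1 ≠ p.2 := by simpa [offDiag] using hp
    have h1 : ν.real (A p.1 ∆ A p.2) ≤ 1 := measureReal_le_one
    exact pow_le_pow_left₀ (sub_nonneg.2 h1) (by linarith [hsep hp']) _
  have hcard : #offDiag ≤ Fintype.card ι ^ 2 :=
    (Finset.card_le_univ _).trans_eq (by rw [Fintype.card_prod, sq])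
  calc (Measure.pi fun _ : κ => ν).real {y | ¬ Function.Injective fun i => y ⁻¹' A i}
      ≤ ∑ p ∈ offDiag, (Measure.pi fun _ : κ => ν).real {y | y ⁻¹' A p.1 = y ⁻¹' A p.2} :=
        (measureReal_mono hcover (measure_ne_top _ _)).trans (measureReal_biUnion_finset_le _ _)
    _ ≤ #offDiag • (1 - δ) ^ Fintype.card κ := Finset.sum_le_card_nsmul _ _ _ hpair
    _ ≤ Fintype.card ι ^ 2 * (1 - δ) ^ Fintype.card κ := by
        rw [nsmul_eq_mul]
        exact mul_le_mul_of_nonneg_right (by exact_mod_cast hcard)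
          (pow_nonneg (sub_nonneg.2 hδ) _)

theorem frequently_pi_injective_preimage {ι κ : Type*} [Fintype ι] [Fintype κ]
    {A : ι → Set β} (hA : ∀ i, MeasurableSet (A i)) {δ : ℝ} (hδ : δ ≤ 1)
    (hκ : (Fintype.card ι : ℝ) ^ 2 * (1 - δ) ^ Fintype.card κ < 1)
    (hsep : Pairwise fun i j => δ ≤ ν.real (A i ∆ A j)) :
    ∃ᵐ y : κ → β ∂Measure.pi fun _ => ν, Function.Injective fun i => y ⁻¹' A i := by
  intro hae
  have hone :
      (Measure.pi fun _ : κ => ν).real {y | ¬ Function.Injective fun i => y ⁻¹' A i} = 1 := by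
    rw [measureReal_congr (Filter.eventuallyEq_univ.2 hae), probReal_univ]
  linarith [measureReal_pi_not_injective_preimage_le (κ := κ) hA hδ hsep]

end Sampling

section Packing

variable {α β : Type*} [MeasurableSpace α] [MeasurableSpace β] {μ : Measure α}
  [IsProbabilityMeasure μ] {ν : Measure β} [IsProbabilityMeasure ν]

theorem exists_ae_exists_not_of_frequently_pairwise {r : α → α → Prop} (hr : ∀ x y, r x y → r y x)
    {n : ℕ}
    (h : ∃ᵐ x : Fin n → α ∂Measure.pi fun _ => μ, Pairwise fun i j => r (x i) (x j))
    (h' : ¬ ∃ᵐ x : Fin (n + 1) → α ∂Measure.pi fun _ => μ, Pairwise fun i j => r (x i) (x j)) :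
    ∃ x : Fin n → α, ∀ᵐ z ∂μ, ∃ i, ¬ r z (x i) := by
  have hprod : ∀ᵐ p ∂μ.prod (Measure.pi fun _ : Fin n => μ), ¬ Pairwise fun i j =>
      r (Fin.cons (α := fun _ => α) p.1 p.2 i) (Fin.cons (α := fun _ => α) p.1 p.2 j) := by
    simpa [Fin.insertNthEquiv_apply] using ((measurePreserving_piFinSuccAbove
      (fun _ : Fin (n + 1) => μ) 0).symm).quasiMeasurePreserving.ae (Filter.not_frequently.1 h')
  have hcons := Measure.ae_ae_of_ae_prod
    (Measure.measurePreserving_swap.quasiMeasurePreserving.ae hprod)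
  obtain ⟨x, hx, hxz⟩ := (h.and_eventually hcons).exists
  refine ⟨x, hxz.mono fun z hz => ?_⟩
  by_contra! hzx
  refine hz fun i j hij => ?_
  cases i using Fin.cases <;> cases j using Fin.cases
  · exact absurd rfl hij
  · exact hzx _
  · exact hr _ _ (hzx _)
  · exact hx (ne_of_apply_ne Fin.succ hij)

theorem exists_ae_exists_not_of_card_le {r : α → α → Prop} (hr : ∀ x y, r x y → r y x) {N : ℝ}
    (hN : ∀ n : ℕ, (∃ᵐ x : Fin n → α ∂Measure.pi fun _ => μ, Pairwise fun i j => r (x i) (x j)) →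
      (n : ℝ) ≤ N) :
    ∃ n : ℕ, (n : ℝ) ≤ N ∧ ∃ x : Fin n → α, ∀ᵐ z ∂μ, ∃ i, ¬ r z (x i) := by
  by_contra hnet
  have hfreq : ∀ n : ℕ,
      ∃ᵐ x : Fin n → α ∂Measure.pi fun _ => μ, Pairwise fun i j => r (x i) (x j) := by
    intro n
    induction n with
    | zero => exact Filter.Frequently.of_forall fun x i => i.elim0
    | succ n ih =>
      by_contra hn
      obtain ⟨x, hx⟩ := exists_ae_exists_not_of_frequently_pairwise hr ih hn
      exact hnet ⟨n, hN n ih, x, hx⟩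
  obtain ⟨n, hn⟩ := exists_nat_gt N
  exact hn.not_ge (hN n (hfreq n))

theorem sq_mul_one_sub_pow_lt_one {m δ : ℝ} {t : ℕ} (hm : 0 < m) (hδ : δ ≤ 1)
    (ht : 2 * Real.log m < δ * t) : m ^ 2 * (1 - δ) ^ t < 1 := by
  calc m ^ 2 * (1 - δ) ^ t ≤ m ^ 2 * Real.exp (-δ) ^ t := by
        gcongr
        exact Real.one_sub_le_exp_neg δ
    _ = Real.exp (2 * Real.log m - δ * t) := by
        rw [← Real.exp_nat_mul, Real.exp_sub, two_mul, Real.exp_add, Real.exp_log hm,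
          mul_neg, Real.exp_neg, mul_comm δ]
        ring
    _ < 1 := Real.exp_lt_one_iff.2 (by linarith)

theorem exists_pow_eq_and_log_le {m : ℝ} (hm : 1 ≤ m) {k : ℕ} (hk : k ≠ 0) :
    ∃ r : ℝ, 1 ≤ r ∧ r ^ k = m ∧ Real.log m ≤ k * (r - 1) := by
  have hr : 1 ≤ m ^ (k : ℝ)⁻¹ := Real.one_le_rpow hm (by positivity)
  have hrm : (m ^ (k : ℝ)⁻¹) ^ k = m := Real.rpow_inv_natCast_pow (by linarith) hk
  refine ⟨m ^ (k : ℝ)⁻¹, hr, hrm, ?_⟩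
  nth_rw 1 [← hrm]
  rw [Real.log_pow]
  gcongr
  exact Real.log_le_sub_one_of_pos (by linarith)

theorem le_div_pow_of_forall_le_pow {m D : ℕ} {δ : ℝ} (hδ₀ : 0 < δ) (hδ₁ : δ ≤ 1)
    (h : ∀ t : ℕ, (m : ℝ) ^ 2 * (1 - δ) ^ t < 1 → m ≤ (t + 1) ^ D) :
    (m : ℝ) ≤ (4 * D / δ) ^ (2 * D) := by
  rcases m.eq_zero_or_pos with rfl | hm
  · rw [Nat.cast_zero]; positivity
  have hm₁ : (1 : ℝ) ≤ m := by exact_mod_cast hm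
  let t := ⌊2 * Real.log m / δ⌋₊ + 1
  have ht : 2 * Real.log m < δ * t := by
    rw [← div_lt_iff₀' hδ₀]; exact_mod_cast Nat.lt_floor_add_one _
  have hmt : (m : ℝ) ≤ (t + 1) ^ D := by
    exact_mod_cast h t (sq_mul_one_sub_pow_lt_one (by linarith) hδ₁ ht)
  rcases D.eq_zero_or_pos with rfl | hD
  · simpa using hmt
  have hD₁ : (1 : ℝ) ≤ D := by exact_mod_cast hD
  obtain ⟨r, hr₁, hrm, hlog⟩ := exists_pow_eq_and_log_le hm₁ (mul_ne_zero two_ne_zero hD.ne')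
  push_cast at hlog
  have htr : (t + 1 : ℝ) ≤ 4 * D / δ * r := by
    have hfloor : (t : ℝ) ≤ 2 * Real.log m / δ + 1 := by
      push_cast [t]
      gcongr
      exact Nat.floor_le (div_nonneg (by linarith [Real.log_nonneg hm₁]) hδ₀.le)
    calc (t + 1 : ℝ) ≤ 2 * Real.log m / δ + 2 := by linarith
      _ ≤ 2 * (2 * D * (r - 1)) / δ + 4 * D / δ := by
          gcongr
          rw [le_div_iff₀ hδ₀]
          linarith
      _ = 4 * D / δ * r := by ring
  have hsqrt : r ^ D ≤ (4 * D / δ) ^ D := by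
    refine le_of_mul_le_mul_right ?_ (pow_pos (by linarith : 0 < r) D)
    calc r ^ D * r ^ D = m := by rw [← hrm, two_mul, pow_add]
      _ ≤ (4 * D / δ * r) ^ D := hmt.trans (by gcongr)
      _ = (4 * D / δ) ^ D * r ^ D := mul_pow _ _ _
  calc (m : ℝ) = (r ^ D) ^ 2 := by rw [← hrm, mul_comm, pow_mul]
    _ ≤ ((4 * D / δ) ^ D) ^ 2 := by gcongr
    _ = (4 * D / δ) ^ (2 * D) := by rw [mul_comm 2, pow_mul]

namespace Bigraph

variable {U₁ U₂ : Type*} [Fintype U₁] [Fintype U₂] {F : Bigraph U₁ U₂} {A : α → Set β}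

theorem card_le_pow_of_frequently_separated (hA : ∀ x, MeasurableSet (A x))
    (hF : ∀ᵐ x ∂Measure.pi fun _ => μ, ∀ᵐ y ∂Measure.pi fun _ => ν, ¬ F.IsInducedCopy A x y)
    {ι κ : Type*} [Fintype ι] [Fintype κ] {δ : ℝ} (hδ : δ ≤ 1)
    (hκ : (Fintype.card ι : ℝ) ^ 2 * (1 - δ) ^ Fintype.card κ < 1)
    (hsep : ∃ᵐ x : ι → α ∂Measure.pi fun _ => μ,
      Pairwise fun i j => δ < ν.real (A (x i) ∆ A (x j))) :
    Fintype.card ι ≤ (Fintype.card κ + 1) ^ Fintype.card (U₁ ⊕ U₂) := by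
  have hrows : ∀ᵐ x : ι → α ∂Measure.pi fun _ => μ, ∀ f : U₁ → ι, Function.Injective f →
      ∀ᵐ y ∂Measure.pi fun _ => ν, ¬ F.IsInducedCopy A (x ∘ f) y := by
    simp only [ae_all_iff]
    exact fun f hf =>
      (measurePreserving_pi_reindex (fun _ => μ) hf).quasiMeasurePreserving.ae hF
  obtain ⟨x, hx, hxF⟩ := (hsep.and_eventually hrows).exists
  have hcols : ∀ᵐ y : κ → β ∂Measure.pi fun _ => ν, ∀ f : U₁ → ι, Function.Injective f →
      ∀ g : U₂ → κ, Function.Injective g → ¬ F.IsInducedCopy A (x ∘ f) (y ∘ g) := by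
    simp only [ae_all_iff]
    exact fun f hf g hg =>
      (measurePreserving_pi_reindex (fun _ => ν) hg).quasiMeasurePreserving.ae (hxF f hf)
  obtain ⟨y, hy, hyF⟩ := ((frequently_pi_injective_preimage (fun i => hA (x i)) hδ hκ
    fun i j hij => (hx hij).le).and_eventually hcols).exists
  by_contra! hlt
  obtain ⟨f, g, hf, hg, hfg⟩ := F.exists_isInducedCopy_of_pow_lt_card hy hlt
  exact hyF f hf g hg hfg

theorem exists_net (hA : ∀ x, MeasurableSet (A x))
    (hF : ∀ᵐ x ∂Measure.pi fun _ => μ, ∀ᵐ y ∂Measure.pi fun _ => ν, ¬ F.IsInducedCopy A x y)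
    {δ : ℝ} (hδ₀ : 0 < δ) (hδ₁ : δ ≤ 1) :
    ∃ n : ℕ, (n : ℝ) ≤ (4 * Fintype.card (U₁ ⊕ U₂) / δ) ^ (2 * Fintype.card (U₁ ⊕ U₂)) ∧
      ∃ x : Fin n → α, ∀ᵐ z ∂μ, ∃ i, ν.real (A z ∆ A (x i)) ≤ δ := by
  simp only [← not_lt (a := δ)]
  refine exists_ae_exists_not_of_card_le (r := fun z z' => δ < ν.real (A z ∆ A z'))
    (fun z z' h => by rwa [symmDiff_comm]) fun n hn =>
      le_div_pow_of_forall_le_pow hδ₀ hδ₁ fun t ht => ?_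
  simpa using card_le_pow_of_frequently_separated hA hF (κ := Fin t) hδ₁ (by simpa using ht) hn

end Bigraph

end Packing

section Exclusion

theorem exists_ae_of_ae_pi_exists {ι : Type*} [Fintype ι] {α : ι → Type*}
    [∀ i, MeasurableSpace (α i)] {μ : ∀ i, Measure (α i)} [∀ i, SigmaFinite (μ i)]
    {p : ∀ i, α i → Prop} (h : ∀ᵐ x ∂Measure.pi μ, ∃ i, p i (x i)) : ∃ i, ∀ᵐ x ∂μ i, p i x := by
  have hnull : Measure.pi μ (Set.univ.pi fun i => {x | ¬ p i x}) = 0 := by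
    rw [← ae_iff.1 h]
    congr 1 with x
    simp
  rw [Measure.pi_pi, Finset.prod_eq_zero_iff] at hnull
  obtain ⟨i, -, hi⟩ := hnull
  exact ⟨i, ae_iff.2 hi⟩

theorem ae_ae_of_ae_ae_pi_exists {α β ι κ : Type*} [MeasurableSpace α] [MeasurableSpace β]
    [Fintype ι] [Fintype κ] {μ : Measure α} {ν : Measure β} [SigmaFinite μ] [SigmaFinite ν]
    {p : α → β → Prop} (hp : MeasurableSet {z : α × β | p z.1 z.2})
    (h : ∀ᵐ x ∂Measure.pi fun _ : ι => μ, ∀ᵐ y ∂Measure.pi fun _ : κ => ν, ∃ i j, p (x i) (y j)) :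
    ∀ᵐ x ∂μ, ∀ᵐ y ∂ν, p x y := by
  have hrow : ∀ᵐ x ∂Measure.pi fun _ : ι => μ, ∀ᵐ y ∂ν, ∃ i, p (x i) y :=
    h.mono fun x hx => by
      simp only [exists_comm (α := ι)] at hx
      have ⟨_, hy⟩ := exists_ae_of_ae_pi_exists (p := fun _ : κ => fun y => ∃ i, p (x i) y) hx
      exact hy
  have hmeas : MeasurableSet {z : (ι → α) × β | ∃ i, p (z.1 i) z.2} := by
    simp only [Set.ofPred_exists]
    exact MeasurableSet.iUnion fun i =>
      hp.preimage (f := fun z : (ι → α) × β => (z.1 i, z.2)) (by fun_prop)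
  rw [Measure.ae_ae_comm hmeas] at hrow
  rw [Measure.ae_ae_comm hp]
  refine hrow.mono fun y hy => ?_
  have ⟨_, hx⟩ := exists_ae_of_ae_pi_exists (p := fun _ : ι => (p · y)) hy
  exact hx

namespace Bigraphon

variable {J₁ J₂ : Type*} [MeasurableSpace J₁] [MeasurableSpace J₂] {U₁ U₂ : Type*} [Fintype U₁]
  [Fintype U₂] (W : Bigraphon J₁ J₂) (F : Bigraph U₁ U₂)

theorem measurable_indWeight : Measurable (Function.uncurry (W.indWeight F)) := by
  have h : ∀ e : U₁ × U₂, Measurable fun z : (U₁ → J₁) × (U₂ → J₂) =>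
      W.toFun (z.1 e.1) (z.2 e.2) := fun e =>
    W.measurable_uncurry.comp (f := fun z : (U₁ → J₁) × (U₂ → J₂) => (z.1 e.1, z.2 e.2))
      (by fun_prop)
  unfold Function.uncurry indWeight
  exact (Finset.measurable_fun_prod _ fun e _ => h e).mul
    (Finset.measurable_fun_prod _ fun e _ => (h e).const_sub 1)

theorem indWeight_nonneg (x : U₁ → J₁) (y : U₂ → J₂) : 0 ≤ W.indWeight F x y :=
  mul_nonneg (Finset.prod_nonneg fun _ _ => (W.mem_Icc _ _).1)
    (Finset.prod_nonneg fun _ _ => sub_nonneg.2 (W.mem_Icc _ _).2)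

theorem indWeight_le_one (x : U₁ → J₁) (y : U₂ → J₂) : W.indWeight F x y ≤ 1 :=
  mul_le_one₀ (Finset.prod_le_one (fun _ _ => (W.mem_Icc _ _).1) fun _ _ => (W.mem_Icc _ _).2)
    (Finset.prod_nonneg fun _ _ => sub_nonneg.2 (W.mem_Icc _ _).2)
    (Finset.prod_le_one (fun _ _ => sub_nonneg.2 (W.mem_Icc _ _).2) fun _ _ =>
      sub_le_self _ (W.mem_Icc _ _).1)

variable {W F} {π₁ : Measure J₁} {π₂ : Measure J₂} [IsProbabilityMeasure π₁]
  [IsProbabilityMeasure π₂]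

theorem indWeight_pos {x : U₁ → J₁} {y : U₂ → J₂}
    (h₁ : ∀ i j, (i, j) ∈ F.edges → W.toFun (x i) (y j) ≠ 0)
    (h₂ : ∀ i j, (i, j) ∉ F.edges → W.toFun (x i) (y j) ≠ 1) : 0 < W.indWeight F x y := by
  classical
  refine mul_pos (Finset.prod_pos fun e he => ?_) (Finset.prod_pos fun e he => sub_pos.2 ?_)
  · exact (W.mem_Icc _ _).1.lt_of_ne' (h₁ _ _ (Finset.mem_filter.1 he).2)
  · exact (W.mem_Icc _ _).2.lt_of_ne (h₂ _ _ (Finset.mem_filter.1 he).2)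

theorem ae_ae_indWeight_eq_zero (h : W.indDensity π₁ π₂ F = 0) :
    ∀ᵐ x ∂Measure.pi fun _ => π₁, ∀ᵐ y ∂Measure.pi fun _ => π₂, W.indWeight F x y = 0 := by
  have hint : Integrable (fun z : (U₁ → J₁) × (U₂ → J₂) => W.indWeight F z.1 z.2)
      ((Measure.pi fun _ => π₁).prod (Measure.pi fun _ => π₂)) :=
    Integrable.of_bound (W.measurable_indWeight F).aestronglyMeasurable 1 <|
      Filter.Eventually.of_forall fun z => by
        rw [Real.norm_of_nonneg (W.indWeight_nonneg F z.1 z.2)]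
        exact W.indWeight_le_one F z.1 z.2
  rw [indDensity, integral_integral hint] at h
  have hnonneg : 0 ≤ fun z : (U₁ → J₁) × (U₂ → J₂) => W.indWeight F z.1 z.2 :=
    fun z => W.indWeight_nonneg F z.1 z.2
  rw [integral_eq_zero_iff_of_nonneg hnonneg hint] at h
  exact Measure.ae_ae_of_ae_prod h

theorem ae_ae_eq_zero_or_one (h : W.indDensity π₁ π₂ F = 0) :
    ∀ᵐ x ∂π₁, ∀ᵐ y ∂π₂, W.toFun x y = 0 ∨ W.toFun x y = 1 := by
  refine ae_ae_of_ae_ae_pi_exists (ι := U₁) (κ := U₂)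
    (W.measurable_uncurry (Set.toFinite {0, 1}).measurableSet) ?_
  filter_upwards [ae_ae_indWeight_eq_zero h] with x hx
  filter_upwards [hx] with y hxy
  by_contra! hne
  exact (indWeight_pos (fun i j _ => (hne i j).1) fun i j _ => (hne i j).2).ne' hxy

theorem ae_ae_not_isInducedCopy (h : W.indDensity π₁ π₂ F = 0) :
    ∀ᵐ x ∂Measure.pi fun _ => π₁, ∀ᵐ y ∂Measure.pi fun _ => π₂,
      ¬ F.IsInducedCopy (fun x => Function.support (W.toFun x)) x y := by
  filter_upwards [ae_ae_indWeight_eq_zero h] with x hx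
  filter_upwards [hx] with y hxy hcopy
  refine (indWeight_pos (fun i j hij => (hcopy i j).2 hij) fun i j hij h₁ => ?_).ne' hxy
  exact hij ((hcopy i j).1 (by simp [h₁]))

end Bigraphon

end Exclusion

section KernelAveraging

variable {α β E : Type*} [MeasurableSpace α] [MeasurableSpace β] [NormedAddCommGroup E]
  {f : α → β → E}

theorem lintegral_le_of_ae_le_const {μ : Measure α} [IsProbabilityMeasure μ] {g : α → ℝ≥0∞}
    {η : ℝ≥0∞} (h : ∀ᵐ x ∂μ, g x ≤ η) : ∫⁻ x, g x ∂μ ≤ η :=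
  (lintegral_mono_ae h).trans_eq (by rw [lintegral_const, measure_univ, mul_one])

theorem measurable_lintegral_enorm_sub_fst (κ : Kernel α α) [IsSFiniteKernel κ]
    (hf : StronglyMeasurable (Function.uncurry f)) :
    Measurable fun z : α × β => ∫⁻ x', ‖f z.1 z.2 - f x' z.2‖ₑ ∂κ z.1 := by
  refine Measurable.lintegral_kernel_prod_right' (κ := κ.comap Prod.fst measurable_fst)
    (f := fun w : (α × β) × α => ‖f w.1.1 w.1.2 - f w.2 w.1.2‖ₑ) ?_
  exact ((hf.comp_measurable measurable_fst).sub
    (hf.comp_measurable (g := fun w : (α × β) × α => (w.2, w.1.2)) (by fun_prop))).enorm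

variable {κ : Kernel α α} [IsMarkovKernel κ] {μ : Measure α} {ν : Measure β}
  [IsProbabilityMeasure μ] [IsProbabilityMeasure ν]

theorem lintegral_enorm_sub_kernel_fst_le (hf : StronglyMeasurable (Function.uncurry f)) {η : ℝ≥0∞}
    (h : ∀ᵐ x ∂μ, ∀ᵐ x' ∂κ x, ∫⁻ y, ‖f x y - f x' y‖ₑ ∂ν ≤ η) :
    ∫⁻ x, ∫⁻ y, ∫⁻ x', ‖f x y - f x' y‖ₑ ∂κ x ∂ν ∂μ ≤ η := by
  refine lintegral_le_of_ae_le_const (h.mono fun x hx => ?_)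
  have hmeas : AEMeasurable (Function.uncurry fun y x' => ‖f x y - f x' y‖ₑ) (ν.prod (κ x)) :=
    ((hf.comp_measurable (g := fun w : β × α => (x, w.1)) (by fun_prop)).sub
      (hf.comp_measurable measurable_swap)).enorm.aemeasurable
  rw [lintegral_lintegral_swap hmeas]
  exact lintegral_le_of_ae_le_const hx

theorem lintegral_lintegral_lintegral_of_invariant (hκ : κ.Invariant μ) {g : α → β → ℝ≥0∞}
    (hg : Measurable (Function.uncurry g)) :
    ∫⁻ x, ∫⁻ y, ∫⁻ x', g x' y ∂κ x ∂ν ∂μ = ∫⁻ y, ∫⁻ x, g x y ∂μ ∂ν := by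
  have hmeas : Measurable fun z : α × β => ∫⁻ x', g x' z.2 ∂κ z.1 :=
    Measurable.lintegral_kernel_prod_right' (κ := κ.comap Prod.fst measurable_fst)
      (f := fun w : (α × β) × α => g w.2 w.1.2) (by fun_prop)
  rw [lintegral_lintegral_swap hmeas.aemeasurable]
  refine lintegral_congr fun y => ?_
  rw [← Measure.lintegral_bind κ.aemeasurable (by fun_prop), hκ]

variable [NormedSpace ℝ E] [CompleteSpace E]

theorem enorm_sub_integral_prod_le {p : Measure α} {q : Measure β} [IsProbabilityMeasure p]
    [IsProbabilityMeasure q] (hf : StronglyMeasurable (Function.uncurry f))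
    (hint : Integrable (fun z => f z.1 z.2) (p.prod q)) (x : α) (y : β) :
    ‖f x y - ∫ z, f z.1 z.2 ∂p.prod q‖ₑ ≤
      ∫⁻ x', ‖f x y - f x' y‖ₑ ∂p + ∫⁻ x', ∫⁻ y', ‖f x' y - f x' y'‖ₑ ∂q ∂p := by
  have hsection : StronglyMeasurable fun x' => f x' y :=
    hf.comp_measurable (g := fun x' => (x', y)) (by fun_prop)
  calc ‖f x y - ∫ z, f z.1 z.2 ∂p.prod q‖ₑ
      = ‖∫ z, (f x y - f z.1 z.2) ∂p.prod q‖ₑ := by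
        rw [integral_sub (integrable_const _) hint, integral_const, probReal_univ, one_smul]
    _ ≤ ∫⁻ z, ‖f x y - f z.1 z.2‖ₑ ∂p.prod q := enorm_integral_le_lintegral_enorm _
    _ ≤ ∫⁻ x', ∫⁻ y', ‖f x y - f x' y'‖ₑ ∂q ∂p := lintegral_prod_le _
    _ ≤ ∫⁻ x', (‖f x y - f x' y‖ₑ + ∫⁻ y', ‖f x' y - f x' y'‖ₑ ∂q) ∂p := by
        refine lintegral_mono fun x' => ?_
        calc ∫⁻ y', ‖f x y - f x' y'‖ₑ ∂q
            ≤ ∫⁻ y', (‖f x y - f x' y‖ₑ + ‖f x' y - f x' y'‖ₑ) ∂q :=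
              lintegral_mono fun y' => by
                rw [← sub_add_sub_cancel (f x y) (f x' y)]
                exact enorm_add_le _ _
          _ = ‖f x y - f x' y‖ₑ + ∫⁻ y', ‖f x' y - f x' y'‖ₑ ∂q := by
              rw [lintegral_add_left measurable_const, lintegral_const, measure_univ, mul_one]
    _ = ∫⁻ x', ‖f x y - f x' y‖ₑ ∂p + ∫⁻ x', ∫⁻ y', ‖f x' y - f x' y'‖ₑ ∂q ∂p :=
        lintegral_add_left (stronglyMeasurable_const.sub hsection).enorm _

theorem lintegral_enorm_sub_integral_prod_kernel_le {κ' : Kernel β β} [IsMarkovKernel κ']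
    (hκ : κ.Invariant μ) (hf : StronglyMeasurable (Function.uncurry f))
    (hint : ∀ x y, Integrable (fun z => f z.1 z.2) ((κ x).prod (κ' y))) {η η' : ℝ≥0∞}
    (hrow : ∀ᵐ x ∂μ, ∀ᵐ x' ∂κ x, ∫⁻ y, ‖f x y - f x' y‖ₑ ∂ν ≤ η)
    (hcol : ∀ᵐ y ∂ν, ∀ᵐ y' ∂κ' y, ∫⁻ x, ‖f x y - f x y'‖ₑ ∂μ ≤ η') :
    ∫⁻ x, ∫⁻ y, ‖f x y - ∫ z, f z.1 z.2 ∂(κ x).prod (κ' y)‖ₑ ∂ν ∂μ ≤ η + η' := by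
  have hfswap : StronglyMeasurable (Function.uncurry fun y x => f x y) :=
    hf.comp_measurable measurable_swap
  have hrowMeas := measurable_lintegral_enorm_sub_fst κ hf
  have hcolMeas : Measurable (Function.uncurry fun x y => ∫⁻ y', ‖f x y - f x y'‖ₑ ∂κ' y) :=
    (measurable_lintegral_enorm_sub_fst κ' hfswap).comp measurable_swap
  calc ∫⁻ x, ∫⁻ y, ‖f x y - ∫ z, f z.1 z.2 ∂(κ x).prod (κ' y)‖ₑ ∂ν ∂μ
      ≤ ∫⁻ x, ∫⁻ y, (∫⁻ x', ‖f x y - f x' y‖ₑ ∂κ x +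
          ∫⁻ x', ∫⁻ y', ‖f x' y - f x' y'‖ₑ ∂κ' y ∂κ x) ∂ν ∂μ :=
        lintegral_mono fun x => lintegral_mono fun y =>
          enorm_sub_integral_prod_le hf (hint x y) x y
    _ = ∫⁻ x, ∫⁻ y, ∫⁻ x', ‖f x y - f x' y‖ₑ ∂κ x ∂ν ∂μ +
          ∫⁻ x, ∫⁻ y, ∫⁻ x', ∫⁻ y', ‖f x' y - f x' y'‖ₑ ∂κ' y ∂κ x ∂ν ∂μ := by
        rw [← lintegral_add_left hrowMeas.lintegral_prod_right']
        exact lintegral_congr fun x => lintegral_add_left (hrowMeas.comp measurable_prodMk_left) _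
    _ = ∫⁻ x, ∫⁻ y, ∫⁻ x', ‖f x y - f x' y‖ₑ ∂κ x ∂ν ∂μ +
          ∫⁻ y, ∫⁻ x, ∫⁻ y', ‖f x y - f x y'‖ₑ ∂κ' y ∂μ ∂ν := by
        rw [lintegral_lintegral_lintegral_of_invariant hκ hcolMeas]
    _ ≤ η + η' := add_le_add (lintegral_enorm_sub_kernel_fst_le hf hrow)
        (lintegral_enorm_sub_kernel_fst_le hfswap hcol)

end KernelAveraging

section FiberPartition

theorem exists_measurable_forall_mem {α ι : Type*} [MeasurableSpace α] [MeasurableSpace ι]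
    [Countable ι] [Nonempty ι] {C : ι → Set α} (hC : ∀ i, MeasurableSet (C i)) :
    ∃ X : α → ι, Measurable X ∧ ∀ x ∈ ⋃ i, C i, x ∈ C (X x) := by
  classical
  obtain ⟨g, hg⟩ := exists_surjective_nat ι
  have hex : ∀ x, ∃ k, x ∈ ⋃ i, C i → x ∈ C (g k) := fun x => by
    by_cases hx : x ∈ ⋃ i, C i
    · obtain ⟨i, hi⟩ := Set.mem_iUnion.1 hx
      obtain ⟨k, rfl⟩ := hg i
      exact ⟨k, fun _ => hi⟩
    · exact ⟨0, fun h => absurd h hx⟩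
  refine ⟨fun x => g (Nat.find (hex x)), measurable_from_nat.comp (measurable_find hex fun k => ?_),
    fun x hx => Nat.find_spec (hex x) hx⟩
  exact (MeasurableSet.iUnion hC).imp (hC (g k))

theorem exists_ae_eq_forall_measure_fiber_ne_zero {α ι : Type*} [MeasurableSpace α]
    {μ : Measure α} [NeZero μ] [MeasurableSpace ι] [DiscreteMeasurableSpace ι] [Countable ι]
    {X : α → ι} (hX : Measurable X) :
    ∃ Y : α → ι, Measurable Y ∧ Y =ᵐ[μ] X ∧ ∀ x, μ (Y ⁻¹' {Y x}) ≠ 0 := by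
  classical
  have hae : ∀ᵐ x ∂μ, μ (X ⁻¹' {X x}) ≠ 0 := by
    have hnull : ∀ i, ∀ᵐ x ∂μ, μ (X ⁻¹' {i}) = 0 → X x ≠ i := fun i =>
      Filter.eventually_imp_distrib_left.2 measure_eq_zero_iff_ae_notMem.1
    filter_upwards [ae_all_iff.2 hnull] with x hx h₀ using hx _ h₀ rfl
  obtain ⟨x₀, hx₀⟩ := hae.exists
  let g : ι → ι := fun i => if μ (X ⁻¹' {i}) = 0 then X x₀ else i
  have hg : ∀ i, μ (X ⁻¹' {g i}) ≠ 0 := fun i => by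
    by_cases hi : μ (X ⁻¹' {i}) = 0 <;> simp [g, hi, hx₀]
  have hfix : ∀ i, μ (X ⁻¹' {i}) ≠ 0 → g i = i := fun i hi => if_neg hi
  refine ⟨g ∘ X, Measurable.of_discrete.comp hX, hae.mono fun x hx => hfix _ hx, fun x => ?_⟩
  refine ne_of_gt ((pos_iff_ne_zero.2 (hg (X x))).trans_le (measure_mono fun z hz => ?_))
  have hz : X z = g (X x) := hz
  change g (X z) = g (X x)
  rw [hz, hfix _ (hg _)]

variable {J ι : Type*} {X : J → ι}

section Partition

variable [Fintype ι]

/-- The partition of the domain of `X` into the nonempty fibres of `X`. -/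
noncomputable def fiberPartition (X : J → ι) : Finset (Set J) :=
  (Setoid.finite_classes_ker X).toFinset

theorem coe_fiberPartition (X : J → ι) :
    (fiberPartition X : Set (Set J)) = (Setoid.ker X).classes :=
  Set.Finite.coe_toFinset _

theorem mem_fiberPartition {S : Set J} : S ∈ fiberPartition X ↔ ∃ x, X ⁻¹' {X x} = S := by
  rw [← Finset.mem_coe, coe_fiberPartition]
  exact exists_congr fun _ => eq_comm

theorem card_fiberPartition_le (X : J → ι) : #(fiberPartition X) ≤ Fintype.card ι := by
  have := (Setoid.finite_classes_ker X).fintype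
  rw [fiberPartition, Set.Finite.card_toFinset]
  exact Setoid.card_classes_ker_le X

theorem classOf_fiberPartition (x : J) :
    Graphon.classOf (fiberPartition X) x = X ⁻¹' {X x} := by
  refine subset_antisymm (Set.sUnion_subset ?_)
    (Set.subset_sUnion_of_mem ⟨mem_fiberPartition.2 ⟨x, rfl⟩, rfl⟩)
  rintro S ⟨hS, hx⟩
  obtain ⟨x', rfl⟩ := mem_fiberPartition.1 hS
  rw [Set.mem_preimage, Set.mem_singleton_iff] at hx
  rw [hx]

variable [MeasurableSpace J] {π : Measure J}

theorem isMeasurablePartition_fiberPartition [MeasurableSpace ι] [MeasurableSingletonClass ι]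
    (hX : Measurable X) (hpos : ∀ x, π (X ⁻¹' {X x}) ≠ 0) :
    Graphon.IsMeasurablePartition π (fiberPartition X) where
  isPartition := by
    rw [coe_fiberPartition]
    exact Setoid.isPartition_classes _
  measurableSet S hS := by
    obtain ⟨x, rfl⟩ := mem_fiberPartition.1 hS
    exact hX (measurableSet_singleton _)
  measure_pos S hS := by
    obtain ⟨x, rfl⟩ := mem_fiberPartition.1 hS
    exact pos_iff_ne_zero.2 (hpos x)

end Partition

variable [MeasurableSpace J] {π : Measure J} [MeasurableSpace ι] [DiscreteMeasurableSpace ι]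

section Kernel

variable [Countable ι]

/-- The kernel sending a point `x` to the measure `π` conditioned on the fibre of `X` through `x`;
integration against it is averaging over that fibre. -/
noncomputable def fiberKernel (π : Measure J) (hX : Measurable X) : Kernel J J :=
  (Kernel.ofFunOfCountable fun a => π[|X ⁻¹' {a}]).comap X hX

theorem fiberKernel_apply (hX : Measurable X) (x : J) :
    fiberKernel π hX x = π[|X ⁻¹' {X x}] :=
  rfl

theorem isMarkovKernel_fiberKernel [IsFiniteMeasure π] (hX : Measurable X)
    (hpos : ∀ x, π (X ⁻¹' {X x}) ≠ 0) : IsMarkovKernel (fiberKernel π hX) :=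
  ⟨fun x => cond_isProbabilityMeasure (hpos x)⟩

theorem ae_fiberKernel (hX : Measurable X) {p : J → Prop} (hp : ∀ᵐ x ∂π, p x) (x : J) :
    ∀ᵐ x' ∂fiberKernel π hX x, X x' = X x ∧ p x' :=
  (ae_cond_mem (hX (measurableSet_singleton _))).and (cond_absolutelyContinuous.ae_le hp)

end Kernel

theorem invariant_fiberKernel [Finite ι] [IsFiniteMeasure π] (hX : Measurable X) :
    (fiberKernel π hX).Invariant π := by
  have := Fintype.ofFinite ι
  ext s hs
  rw [Measure.bind_apply hs (fiberKernel π hX).aemeasurable]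
  calc ∫⁻ x, π[s|X ⁻¹' {X x}] ∂π = ∫⁻ a, π[s|X ⁻¹' {a}] ∂π.map X :=
        (lintegral_map (f := fun a => π[s|X ⁻¹' {a}]) Measurable.of_discrete hX).symm
    _ = ∑ a, π (X ⁻¹' {a}) * π[s|X ⁻¹' {a}] := by
        simp only [lintegral_fintype, Measure.map_apply hX (measurableSet_singleton _), mul_comm]
    _ = (∑ a, π (X ⁻¹' {a}) • π[|X ⁻¹' {a}]) s := by simp
    _ = π s := by rw [sum_meas_smul_cond_fiber hX]

namespace Graphon

variable (W : Graphon J) [Fintype ι]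

theorem stepAverage_fiberPartition [IsFiniteMeasure π] (hX : Measurable X) (x y : J) :
    W.stepAverage π (fiberPartition X) x y =
      ∫ z, W.toFun z.1 z.2 ∂(fiberKernel π hX x).prod (fiberKernel π hX y) := by
  rw [stepAverage, classOf_fiberPartition, classOf_fiberPartition, fiberKernel_apply,
    fiberKernel_apply, ProbabilityTheory.cond, ProbabilityTheory.cond, Measure.prod_smul_left,
    Measure.prod_smul_right, Measure.prod_restrict, integral_smul_measure, integral_smul_measure]
  simp only [Measure.real, ENNReal.toReal_inv, smul_eq_mul, mul_inv_rev, mul_assoc,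
    mul_left_comm]

end Graphon

end FiberPartition

theorem lintegral_enorm_sub_eq_measure_symmDiff_support {β : Type*} [MeasurableSpace β]
    {ν : Measure β} {f g : β → ℝ} (hf : Measurable f) (hg : Measurable g)
    (hf₀₁ : ∀ᵐ y ∂ν, f y = 0 ∨ f y = 1) (hg₀₁ : ∀ᵐ y ∂ν, g y = 0 ∨ g y = 1) :
    ∫⁻ y, ‖f y - g y‖ₑ ∂ν = ν (Function.support f ∆ Function.support g) := by
  rw [← lintegral_indicator_one ((measurableSet_support hf).symmDiff (measurableSet_support hg))]
  refine lintegral_congr_ae ?_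
  filter_upwards [hf₀₁, hg₀₁] with y hfy hgy
  rcases hfy with hfy | hfy <;> rcases hgy with hgy | hgy <;>
    simp [Set.indicator, Set.mem_symmDiff, hfy, hgy]

namespace Bigraphon

variable {J₁ J₂ : Type*} [MeasurableSpace J₁] [MeasurableSpace J₂] {W : Bigraphon J₁ J₂}
  {π : Measure J₂} [IsFiniteMeasure π] {s : Set J₂} {δ : ℝ}

theorem measurableSet_symmDiff_support_le (hs : MeasurableSet s) :
    MeasurableSet {x | π.real (Function.support (W.toFun x) ∆ s) ≤ δ} := by
  have hsupp : MeasurableSet {z : J₁ × J₂ | W.toFun z.1 z.2 ≠ 0} :=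
    measurableSet_support W.measurable_uncurry
  exact (measurable_measure_prodMk_left
    (hsupp.symmDiff (measurable_snd hs))).ennreal_toReal measurableSet_Iic

theorem lintegral_enorm_sub_le_of_symmDiff_support_le {x x' : J₁}
    (hx₀₁ : ∀ᵐ y ∂π, W.toFun x y = 0 ∨ W.toFun x y = 1)
    (hx'₀₁ : ∀ᵐ y ∂π, W.toFun x' y = 0 ∨ W.toFun x' y = 1)
    (hx : π.real (Function.support (W.toFun x) ∆ s) ≤ δ)
    (hx' : π.real (Function.support (W.toFun x') ∆ s) ≤ δ) :
    ∫⁻ y, ‖W.toFun x y - W.toFun x' y‖ₑ ∂π ≤ ENNReal.ofReal (2 * δ) := by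
  rw [lintegral_enorm_sub_eq_measure_symmDiff_support W.measurable_uncurry.of_uncurry_left
    W.measurable_uncurry.of_uncurry_left hx₀₁ hx'₀₁, ← ofReal_measureReal]
  refine ENNReal.ofReal_le_ofReal ((measureReal_symmDiff_le (t := s) _).trans ?_)
  rw [symmDiff_comm s]
  linarith

end Bigraphon

namespace Graphon

variable {J ι : Type*} [MeasurableSpace J] {π : Measure J} [IsProbabilityMeasure π]
  [Fintype ι] [MeasurableSpace ι] [DiscreteMeasurableSpace ι] {X : J → ι} {W : Graphon J}

theorem isUltraStrongPartition_fiberPartition (hX : Measurable X)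
    (hpos : ∀ x, π (X ⁻¹' {X x}) ≠ 0) {η : ℝ} (hη : 0 ≤ η)
    (hrow : ∀ᵐ x ∂π, ∀ᵐ x' ∂fiberKernel π hX x,
      ∫⁻ y, ‖W.toFun x y - W.toFun x' y‖ₑ ∂π ≤ ENNReal.ofReal η) :
    W.IsUltraStrongPartition π (fiberPartition X) (2 * η) := by
  refine ⟨isMeasurablePartition_fiberPartition hX hpos, ?_⟩
  have := isMarkovKernel_fiberKernel hX hpos
  have hint : ∀ x y, Integrable (fun z : J × J => W.toFun z.1 z.2)
      ((fiberKernel π hX x).prod (fiberKernel π hX y)) := fun x y =>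
    Integrable.of_mem_Icc 0 1 W.measurable_uncurry.aemeasurable (.of_forall fun z => W.mem_Icc _ _)
  have hcol : ∀ᵐ y ∂π, ∀ᵐ y' ∂fiberKernel π hX y,
      ∫⁻ x, ‖W.toFun x y - W.toFun x y'‖ₑ ∂π ≤ ENNReal.ofReal η := by
    simpa only [W.symm _] using hrow
  have herr : ∫⁻ x, ∫⁻ y, ‖W.toFun x y - W.stepAverage π (fiberPartition X) x y‖ₑ ∂π ∂π ≤
      ENNReal.ofReal (2 * η) := by
    simp only [W.stepAverage_fiberPartition hX]
    rw [two_mul, ENNReal.ofReal_add hη hη]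
    exact lintegral_enorm_sub_integral_prod_kernel_le (invariant_fiberKernel hX)
      W.measurable_uncurry.stronglyMeasurable hint hrow hcol
  rw [← ENNReal.ofReal_le_ofReal_iff (by positivity),
    ← Real.enorm_of_nonneg (integral_nonneg fun _ => abs_nonneg _)]
  calc ‖∫ z, |W.toFun z.1 z.2 - W.stepAverage π (fiberPartition X) z.1 z.2| ∂π.prod π‖ₑ
      ≤ ∫⁻ z, ‖|W.toFun z.1 z.2 - W.stepAverage π (fiberPartition X) z.1 z.2|‖ₑ ∂π.prod π :=
        enorm_integral_le_lintegral_enorm _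
    _ ≤ ENNReal.ofReal (2 * η) := by
        simp only [← Real.norm_eq_abs, enorm_norm]
        exact (lintegral_prod_le _).trans herr

end Graphon

theorem theorem5p7_general {U₁ U₂ J : Type*} [Fintype U₁] [Fintype U₂] {F : Bigraph U₁ U₂}
    [MeasurableSpace J] {π : Measure J} [IsProbabilityMeasure π] {W : Graphon J}
    (hF : W.ExcludesInduced π F) {ε : ℝ} (hε₀ : 0 < ε) (hε₁ : ε ≤ 4) :
    ∃ P : Finset (Set J), W.IsUltraStrongPartition π P ε ∧
      (#P : ℝ) ≤ (16 * Fintype.card (U₁ ⊕ U₂) / ε) ^ (2 * Fintype.card (U₁ ⊕ U₂)) := by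
  have hsupp : ∀ x, MeasurableSet (Function.support (W.toFun x)) := fun x =>
    measurableSet_support W.measurable_uncurry.of_uncurry_left
  obtain ⟨n, hn, c, hc⟩ := Bigraph.exists_net hsupp (Bigraphon.ae_ae_not_isInducedCopy hF)
    (δ := ε / 4) (by positivity) (by linarith)
  have : Nonempty (Fin n) := hc.exists.elim fun _ h => h.nonempty
  obtain ⟨X₀, hX₀, hmem⟩ := exists_measurable_forall_mem fun i =>
    Bigraphon.measurableSet_symmDiff_support_le (W := W.toBigraphon) (π := π) (δ := ε / 4)
      (hsupp (c i))
  obtain ⟨X, hX, hXX₀, hpos⟩ := exists_ae_eq_forall_measure_fiber_ne_zero (μ := π) hX₀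
  have hclose : ∀ᵐ x ∂π, π.real
      (Function.support (W.toFun x) ∆ Function.support (W.toFun (c (X x)))) ≤ ε / 4 := by
    filter_upwards [hc, hXX₀] with x hx hXx
    rw [hXx]
    exact hmem x (Set.mem_iUnion.2 hx)
  have hgood := (Bigraphon.ae_ae_eq_zero_or_one hF).and hclose
  have hrow : ∀ᵐ x ∂π, ∀ᵐ x' ∂fiberKernel π hX x,
      ∫⁻ y, ‖W.toFun x y - W.toFun x' y‖ₑ ∂π ≤ ENNReal.ofReal (2 * (ε / 4)) := by
    filter_upwards [hgood] with x hx
    filter_upwards [ae_fiberKernel hX hgood x] with x' ⟨hXx', hx'⟩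
    exact Bigraphon.lintegral_enorm_sub_le_of_symmDiff_support_le hx.1 hx'.1 hx.2 (hXx' ▸ hx'.2)
  refine ⟨fiberPartition X, ?_, ?_⟩
  · convert Graphon.isUltraStrongPartition_fiberPartition hX hpos (by positivity) hrow using 1
    ring
  · calc (#(fiberPartition X) : ℝ) ≤ n := by
          exact_mod_cast (card_fiberPartition_le X).trans_eq (Fintype.card_fin n)
      _ ≤ _ := hn
      _ = _ := by ring

theorem div_pow_le_mul_zpow {C ε : ℝ} (hC : 0 ≤ C) (hε₀ : 0 < ε) (hε₁ : ε ≤ 1) (D : ℕ) :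
    (C / ε) ^ (2 * D) ≤ C ^ (2 * D) * ε ^ (-(10 * (D : ℤ) ^ 2)) := by
  rw [div_eq_mul_inv, mul_pow, zpow_neg, ← inv_zpow, ← zpow_natCast ε⁻¹]
  gcongr
  · exact (one_le_inv₀ hε₀).2 hε₁
  · exact_mod_cast show 2 * D ≤ 10 * D ^ 2 by nlinarith [Nat.le_self_pow two_ne_zero D]

theorem theorem5p7 {U₁ U₂ : Type*} [Fintype U₁] [Fintype U₂] (F : Bigraph U₁ U₂) :
    ∃ c : ℝ, 0 < c ∧
      ∀ (J : Type*) [MeasurableSpace J] (π : Measure J) [IsProbabilityMeasure π] (W : Graphon J),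
        W.ExcludesInduced π F →
        ∀ ε : ℝ, 0 < ε → ε < 1 →
          ∃ P : Finset (Set J), W.IsUltraStrongPartition π P ε ∧
            (P.card : ℝ) ≤
              c * ε ^ (-(10 * ((Fintype.card U₁ + Fintype.card U₂ : ℕ) : ℤ) ^ 2)) := by
  rw [← Fintype.card_sum]
  refine ⟨(16 * Fintype.card (U₁ ⊕ U₂)) ^ (2 * Fintype.card (U₁ ⊕ U₂)), ?_, ?_⟩
  · rcases (Fintype.card (U₁ ⊕ U₂)).eq_zero_or_pos with hD | hD
    · simp [hD]
    · positivity
  · intro J _ π _ W hF ε hε₀ hε₁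
    obtain ⟨P, hP, hcard⟩ := theorem5p7_general hF hε₀ (by linarith)
    exact ⟨P, hP, hcard.trans (div_pow_le_mul_zpow (by positivity) hε₀ hε₁.le _)⟩
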